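/- Let $a>b>0$, $c^2=a^2-b^2$, and let $\mathcal E$ be the ellipse $x^2/a^2+y^2/b^2=1$. Let $\mathcal K$ be a circle with center $C=[x_c,y_c]$ and positive radius, contained together with its interior in the open region bounded by $\mathcal E$, and suppose that $\mathcal E,\mathcal K$ admit Poncelet triangles, i.e. there is a triangle inscribed in $\mathcal E$ whose three sides are tangent to $\mathcal K$. Let $\mathcal L_5$ be the locus of the Euler center $X_5$ (the center of the nine-point circle) over all triangles inscribed in $\mathcal E$ and circumscribed about $\mathcal K$. Then $\mathcal L_5$ is the whole ellipse with foci $$F_5=C=[x_c,y_c],\qquad F_5'=\left[x_c\,\frac{1+(b/a)^2}{2},\; y_c\,\frac{1+(a/b)^2}{2}\right]$$ and with semi-major and semi-minor axis lengths $$a_5=\frac{a^3(a^2+3b^2)\sqrt{b^4+c^2y_c^2}-b^3(3a^2+b^2)\sqrt{a^4-c^2x_c^2}}{4a^2b^2c^2},\qquad b_5=\frac{\left|a(3a^2+b^2)\sqrt{b^4+c^2y_c^2}-b(a^2+3b^2)\sqrt{a^4-c^2x_c^2}\right|}{4abc^2}.$$ (Here $a_5>0$; if $C=O$ the foci coincide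 and $\mathcal L_5$ is a circle; if $b_5=0$ the ellipse degenerates to the segment $F_5F_5'$.) -/

import Mathlib

open EuclideanGeometry

noncomputable section

/-- The Euclidean plane. -/
abbrev Plane : Type := EuclideanSpace ℝ (Fin 2)

/-- The axis-aligned ellipse with semi-axes `a` and `b` centred at the origin. -/
def outerEllipse (a b : ℝ) : Set Plane :=
  {P | P 0 ^ 2 / a ^ 2 + P 1 ^ 2 / b ^ 2 = 1}

/-- The open region bounded by `outerEllipse a b`. -/
def outerEllipseInterior (a b : ℝ) : Set Plane :=
  {P | P 0 ^ 2 / a ^ 2 + P 1 ^ 2 / b ^ 2 < 1}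

/-- A (nondegenerate) triangle with all vertices on the ellipse with semi-axes `a`, `b` and all
three side lines tangent to the circle `K`. -/
structure IsPonceletTriangle (a b : ℝ) (K : Sphere Plane) (T : Affine.Triangle ℝ Plane) :
    Prop where
  inscribed : ∀ i, T.points i ∈ outerEllipse a b
  tangent : ∀ i j, i ≠ j → K.IsTangent line[ℝ, T.points i, T.points j]

/-- `K` is a circular caustic of Poncelet triangles of the ellipse with semi-axes `a`, `b`:
a circle of positive radius, nested inside the ellipse, for which the pair closes on triangles.
Closure is only asked for in the form of one triangle. -/
structure IsCircularCaustic (a b : ℝ) (K : Sphere Plane) : Prop where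
  radius_pos : 0 < K.radius
  nested : Metric.closedBall K.center K.radius ⊆ outerEllipseInterior a b
  closes : ∃ T : Affine.Triangle ℝ Plane, IsPonceletTriangle a b K T

/-- The Euler center `X₅` of a triangle: the center of its nine-point circle. -/
def eulerCenter (T : Affine.Triangle ℝ Plane) : Plane :=
  T.ninePointCircle.center

/-- The locus of `X₅` over all triangles inscribed in the ellipse with semi-axes `a`, `b` and
circumscribed about `K`. -/
def eulerCenterLocus (a b : ℝ) (K : Sphere Plane) : Set Plane :=
  {P | ∃ T : Affine.Triangle ℝ Plane, IsPonceletTriangle a b K T ∧ eulerCenter T = P}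

/-- `S` is the (whole) ellipse with foci `F`, `F'`, semi-major axis `α` and semi-minor axis `β`.
For `F = F'` this is a circle of radius `α = β`; the degenerate value `β = 0` is allowed, and then
`S` is the segment from `F` to `F'`. -/
structure IsEllipseWithFoci (S : Set Plane) (F F' : Plane) (α β : ℝ) : Prop where
  major_pos : 0 < α
  minor_nonneg : 0 ≤ β
  minor_le_major : β ≤ α
  dist_foci : dist F F' = 2 * √(α ^ 2 - β ^ 2)
  eq_setOf : S = {P | dist P F + dist P F' = 2 * α}

/-- The semi-major axis of the locus of `X₅`, as a function of the semi-axes of the outer ellipse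
and of the coordinates of the center of the caustic. -/
def eulerSemiMajor (a b x y : ℝ) : ℝ :=
  (a ^ 3 * (a ^ 2 + 3 * b ^ 2) * √(b ^ 4 + (a ^ 2 - b ^ 2) * y ^ 2)
      - b ^ 3 * (3 * a ^ 2 + b ^ 2) * √(a ^ 4 - (a ^ 2 - b ^ 2) * x ^ 2))
    / (4 * a ^ 2 * b ^ 2 * (a ^ 2 - b ^ 2))

/-- The semi-minor axis of the locus of `X₅`. -/
def eulerSemiMinor (a b x y : ℝ) : ℝ :=
  |a * (3 * a ^ 2 + b ^ 2) * √(b ^ 4 + (a ^ 2 - b ^ 2) * y ^ 2)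
      - b * (a ^ 2 + 3 * b ^ 2) * √(a ^ 4 - (a ^ 2 - b ^ 2) * x ^ 2)|
    / (4 * a * b * (a ^ 2 - b ^ 2))

end

open scoped ComplexConjugate

/-! The map $(X,Y)\mapsto X/a+iY/b$ carries $\mathcal E$ to the unit circle and $\mathcal K$ to an
ellipse with center $m$ and foci $f,g=m\pm it$, where $t^2=r^2(1/b^2-1/a^2)$. Tangency of the chord
$uv$ becomes a symmetric equation, quadratic in each variable. Vieta's formulas for this quadratic
show that a Poncelet triangle with $xyz=l$ has $x+y+z=2m+l\,\overline{fg}$, and that a closure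
condition on $m$ and $r$ alone holds (`symmetric_functions_of_chordForm`).

Conversely, under this condition every unimodular $l$ occurs: the vertices solve
$z(z-f)(z-g)=l(1-\bar fz)(1-\bar gz)$, a Blaschke equation of degree three, all of whose roots are
unimodular (`exists_isPonceletTriangle`).

The circumcenter is real-linear in $x+y+z$ and $xyz$, hence $X_5$ is a constant plus $ql+q'l^{-1}$
(`planeToComplex_eulerCenter`). As $l$ runs over the unit circle this traces an ellipse with
semi-axes $|q|+|q'|$ and $\bigl||q|-|q'|\bigr|$ and with foci at $\pm\sqrt{4qq'}$ from its center
(`exists_unit_iff_sum_norm_eq`). The closure condition turns $4qq'$ into an explicit square and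
$|q|,|q'|$ into the stated radicals. -/

/-! ### Symmetric functions of the vertices of a Poncelet triangle -/

theorem quadratic_coeffs_eq_zero {k : Type*} [Field k] {A B C x y z : k} (hxy : x ≠ y)
    (hxz : x ≠ z) (hyz : y ≠ z) (hx : A * x ^ 2 + B * x + C = 0) (hy : A * y ^ 2 + B * y + C = 0)
    (hz : A * z ^ 2 + B * z + C = 0) : A = 0 ∧ B = 0 ∧ C = 0 := by
  have h1 : A * (x + y) + B = 0 :=
    mul_left_cancel₀ (sub_ne_zero.2 hxy) (by linear_combination hx - hy)
  have h2 : A * (x + z) + B = 0 :=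
    mul_left_cancel₀ (sub_ne_zero.2 hxz) (by linear_combination hx - hz)
  have hA : A = 0 := mul_left_cancel₀ (sub_ne_zero.2 hyz) (by linear_combination h1 - h2)
  subst hA
  have hB : B = 0 := by linear_combination h1
  subst hB
  exact ⟨rfl, rfl, by linear_combination hx⟩

/-- The symmetric correspondence `u ↔ v` on the unit circle expressing that the chord through
`u` and `v` touches a given conic; `n` and `q` play the role of the conjugates of `m` and `p`. -/
def chordForm (m n p q e u v : ℂ) : ℂ :=
  q * (u * v) ^ 2 - 2 * n * (u * v) * (u + v) + (u + v) ^ 2 + 2 * (m * n - e) * (u * v)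
    - 2 * m * (u + v) + p

theorem chordForm_comm (m n p q e u v : ℂ) : chordForm m n p q e u v = chordForm m n p q e v u := by
  unfold chordForm; ring

/-- For fixed `u` the form is a quadratic in its second variable, with the other two vertices as
roots. Multiplying Vieta's product relation by `u` gives a cubic satisfied by all three vertices;
comparison with $(t-x)(t-y)(t-z)$ leaves a quadratic with three distinct roots. The sum relation
then gives the closure condition. -/
theorem symmetric_functions_of_chordForm {m n p q e x y z : ℂ} (hxy : x ≠ y)
    (hxz : x ≠ z) (hyz : y ≠ z) (h1 : chordForm m n p q e x y = 0)
    (h2 : chordForm m n p q e x z = 0) (h3 : chordForm m n p q e y z = 0) :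
    x + y + z = 2 * m + x * y * z * q ∧ x * y + x * z + y * z = p + 2 * n * (x * y * z) ∧
      1 - 2 * (m * n) + p * q = 2 * e := by
  have vieta : ∀ {u v w : ℂ}, v ≠ w → chordForm m n p q e u v = 0 →
      chordForm m n p q e u w = 0 →
      -2 * n * u ^ 2 + 2 * (1 + m * n - e) * u - 2 * m
        + (v + w) * (q * u ^ 2 - 2 * n * u + 1) = 0 ∧
      u ^ 2 - 2 * m * u + p = v * w * (q * u ^ 2 - 2 * n * u + 1) := by
    intro u v w hvw hv hw
    unfold chordForm at hv hw
    have hs : -2 * n * u ^ 2 + 2 * (1 + m * n - e) * u - 2 * m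
        + (v + w) * (q * u ^ 2 - 2 * n * u + 1) = 0 :=
      mul_left_cancel₀ (sub_ne_zero.2 hvw) (by linear_combination hv - hw)
    exact ⟨hs, by linear_combination hv - v * hs⟩
  obtain ⟨sx, px⟩ := vieta hyz h1 h2
  obtain ⟨sy, py⟩ := vieta hxz (by rwa [chordForm_comm]) h3
  obtain ⟨sz, pz⟩ := vieta hxy (u := z) (by rwa [chordForm_comm]) (by rwa [chordForm_comm])
  obtain ⟨c2, c1, -⟩ := quadratic_coeffs_eq_zero (A := x + y + z - 2 * m - x * y * z * q)
    (B := p + 2 * n * (x * y * z) - (x * y + x * z + y * z)) (C := 0) hxy hxz hyz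
    (by linear_combination x * px) (by linear_combination y * py) (by linear_combination z * pz)
  refine ⟨by linear_combination c2, by linear_combination -c1, ?_⟩
  obtain ⟨-, c, -⟩ := quadratic_coeffs_eq_zero (A := 0)
    (B := 1 - 2 * (m * n) + p * q - 2 * e) (C := 0) hxy hxz hyz
    (by linear_combination sx + (2 * n * x - 1) * c2 + q * x * c1)
    (by linear_combination sy + (2 * n * y - 1) * c2 + q * y * c1)
    (by linear_combination sz + (2 * n * z - 1) * c2 + q * z * c1)
  linear_combination c

theorem chordForm_eq_zero {m n p q e x y z : ℂ} (hx : x ≠ 0)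
    (h1 : x + y + z = 2 * m + x * y * z * q)
    (h2 : x * y + x * z + y * z = p + 2 * n * (x * y * z))
    (h3 : 1 - 2 * (m * n) + p * q = 2 * e) : chordForm m n p q e x y = 0 := by
  have hp : y * z * (q * x ^ 2 - 2 * n * x + 1) - (x ^ 2 - 2 * m * x + p) = 0 :=
    mul_left_cancel₀ hx (by linear_combination -x ^ 2 * h1 + x * h2)
  have hs : -2 * n * x ^ 2 + 2 * (1 + m * n - e) * x - 2 * m
        + (y + z) * (q * x ^ 2 - 2 * n * x + 1) = 0 := by
    linear_combination x * (h3 - 2 * n * h1 + q * h2) + h1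
  unfold chordForm
  linear_combination -hp + y * hs

/-! ### Cubics with unimodular roots, from Blaschke products -/

theorem exists_roots_of_cubic (A B C : ℂ) :
    ∃ x y z : ℂ, x + y + z = A ∧ x * y + x * z + y * z = B ∧ x * y * z = C := by
  obtain ⟨x, hx⟩ : ∃ x : ℂ, x ^ 3 - A * x ^ 2 + B * x - C = 0 := by
    obtain ⟨x, hx⟩ := IsAlgClosed.exists_root (Cubic.toPoly ⟨(1 : ℂ), -A, B, -C⟩) (by
      rw [Cubic.degree_of_a_ne_zero (by simp)]; norm_num)
    refine ⟨x, ?_⟩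
    simp only [Cubic.toPoly, Polynomial.IsRoot.def, Polynomial.eval_add, Polynomial.eval_mul,
      Polynomial.eval_C, Polynomial.eval_pow, Polynomial.eval_X] at hx
    linear_combination hx
  obtain ⟨d, hd⟩ := IsAlgClosed.exists_pow_nat_eq ((A - x) ^ 2 - 4 * (B - x * (A - x)))
    (n := 2) (by norm_num)
  exact ⟨x, (A - x + d) / 2, (A - x - d) / 2, by ring,
    by linear_combination (-1 / 4) * hd, by linear_combination (-x / 4) * hd + hx⟩

theorem norm_one_sub_conj_mul_sq (f z : ℂ) :
    ‖1 - conj f * z‖ ^ 2 - ‖z - f‖ ^ 2 = (1 - ‖z‖ ^ 2) * (1 - ‖f‖ ^ 2) := by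
  simp only [← Complex.normSq_eq_norm_sq, Complex.normSq_apply, Complex.sub_re, Complex.sub_im,
    Complex.mul_re, Complex.mul_im, Complex.conj_re, Complex.conj_im, Complex.one_re,
    Complex.one_im]
  ring

/-- Each quotient $(z-f)/(1-\bar fz)$ has modulus less than 1 inside the unit disk and greater than
1 outside, so the two sides can only balance on the circle. -/
theorem norm_eq_one_of_blaschke_eq {f g l z : ℂ} (hf : ‖f‖ < 1) (hg : ‖g‖ < 1) (hl : ‖l‖ = 1)
    (h : z * (z - f) * (z - g) = l * (1 - conj f * z) * (1 - conj g * z)) : ‖z‖ = 1 := by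
  have hn := congrArg norm h
  simp only [norm_mul, hl, one_mul] at hn
  have hf' : 0 < 1 - ‖f‖ ^ 2 := by nlinarith [norm_nonneg f]
  have hg' : 0 < 1 - ‖g‖ ^ 2 := by nlinarith [norm_nonneg g]
  have ef := norm_one_sub_conj_mul_sq f z
  have eg := norm_one_sub_conj_mul_sq g z
  rcases lt_trichotomy ‖z‖ 1 with hz | hz | hz
  · have hz' : 0 < 1 - ‖z‖ ^ 2 := by nlinarith [norm_nonneg z]
    have lf : ‖z - f‖ < ‖1 - conj f * z‖ :=
      lt_of_pow_lt_pow_left₀ 2 (norm_nonneg _) (by linarith [mul_pos hz' hf'])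
    have lg : ‖z - g‖ < ‖1 - conj g * z‖ :=
      lt_of_pow_lt_pow_left₀ 2 (norm_nonneg _) (by linarith [mul_pos hz' hg'])
    have := mul_lt_mul'' lf lg (norm_nonneg _) (norm_nonneg _)
    nlinarith [mul_nonneg (norm_nonneg (z - f)) (norm_nonneg (z - g))]
  · exact hz
  · have hz' : 0 < ‖z‖ ^ 2 - 1 := by nlinarith
    have lf : ‖1 - conj f * z‖ < ‖z - f‖ :=
      lt_of_pow_lt_pow_left₀ 2 (norm_nonneg _) (by linarith [mul_pos hz' hf'])
    have lg : ‖1 - conj g * z‖ < ‖z - g‖ :=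
      lt_of_pow_lt_pow_left₀ 2 (norm_nonneg _) (by linarith [mul_pos hz' hg'])
    have := mul_lt_mul'' lf lg (norm_nonneg _) (norm_nonneg _)
    nlinarith [mul_nonneg (norm_nonneg (z - f)) (norm_nonneg (z - g))]

theorem exists_unit_roots {f g l : ℂ} (hf : ‖f‖ < 1) (hg : ‖g‖ < 1) (hl : ‖l‖ = 1) :
    ∃ x y z : ℂ, ‖x‖ = 1 ∧ ‖y‖ = 1 ∧ ‖z‖ = 1 ∧ x * y * z = l ∧
      x + y + z = f + g + l * conj (f * g) ∧
      x * y + x * z + y * z = f * g + l * conj (f + g) := by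
  obtain ⟨x, y, z, h1, h2, h3⟩ := exists_roots_of_cubic (f + g + l * conj (f * g))
    (f * g + l * conj (f + g)) l
  have key : ∀ t : ℂ, (t - x) * (t - y) * (t - z) = 0 → ‖t‖ = 1 := fun t ht ↦ by
    refine norm_eq_one_of_blaschke_eq hf hg hl ?_
    simp only [map_add, map_mul] at h1 h2
    linear_combination ht + t ^ 2 * h1 - t * h2 + h3
  exact ⟨x, y, z, key x (by ring), key y (by ring), key z (by ring), h3, h1, h2⟩

/-! ### Ellipses as images of the unit circle -/

theorem norm_sub_sq_add_norm_add_sq (x y : ℂ) :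
    ‖(x - y) ^ 2‖ + ‖(x + y) ^ 2‖ = 2 * (‖x‖ ^ 2 + ‖y‖ ^ 2) := by
  simp only [norm_pow, ← Complex.normSq_eq_norm_sq, Complex.normSq_apply, Complex.sub_re,
    Complex.sub_im, Complex.add_re, Complex.add_im]
  ring

theorem exists_sq_eq (z : ℂ) : ∃ w, w ^ 2 = z :=
  IsAlgClosed.exists_pow_nat_eq z (by norm_num)

/-- The image of the unit circle under `l ↦ q * l + r / l` is the ellipse with foci `±d`, where
`d ^ 2 = 4 * q * r`. -/
theorem exists_unit_iff_sum_norm_eq {q r d : ℂ} (hd : d ^ 2 = 4 * q * r) (h0 : 0 < ‖q‖ + ‖r‖)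
    (z : ℂ) : (∃ l : ℂ, ‖l‖ = 1 ∧ z = q * l + r * l⁻¹) ↔ ‖z - d‖ + ‖z + d‖ = 2 * (‖q‖ + ‖r‖) := by
  have sum : ∀ l : ℂ, l ≠ 0 → z = q * l + r * l⁻¹ →
      ‖z - d‖ + ‖z + d‖ = 2 * (‖q‖ * ‖l‖ + ‖r‖ * ‖l‖⁻¹) := by
    intro l hl hz
    -- With $x^2=ql$ and $y^2=r/l$ one has $d=\pm2xy$, so $z\pm d$ are the squares $(x\pm y)^2$ in
    -- some order, and the parallelogram law gives the sum.
    obtain ⟨x, hx⟩ := exists_sq_eq (q * l)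
    obtain ⟨y, hy⟩ := exists_sq_eq (r * l⁻¹)
    have hxy : (2 * x * y - d) * (2 * x * y + d) = 0 := by
      have : q * l * (r * l⁻¹) = q * r := by field_simp
      linear_combination 4 * y ^ 2 * hx + 4 * q * l * hy + 4 * this - hd
    have main := norm_sub_sq_add_norm_add_sq x y
    rw [← norm_pow, ← norm_pow, hx, hy, norm_mul, norm_mul, norm_inv] at main
    rw [← main]
    rcases mul_eq_zero.1 hxy with h | h
    · rw [show z - d = (x - y) ^ 2 by linear_combination hz - hx - hy + h,
        show z + d = (x + y) ^ 2 by linear_combination hz - hx - hy - h]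
    · rw [show z - d = (x + y) ^ 2 by linear_combination hz - hx - hy - h,
        show z + d = (x - y) ^ 2 by linear_combination hz - hx - hy + h, add_comm]
  constructor
  · rintro ⟨l, hl, hz⟩
    have := sum l (by rintro rfl; simp at hl) hz
    simpa [hl] using this
  intro h
  by_cases hq : q = 0
  · subst hq
    have hd0 : d = 0 := by simpa using hd
    have hr : r ≠ 0 := by rintro rfl; simp at h0
    subst hd0
    have hzr : ‖z‖ = ‖r‖ := by simp at h; linarith
    have hz : z ≠ 0 := by rw [← norm_pos_iff, hzr]; exact norm_pos_iff.2 hr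
    refine ⟨r / z, by rw [norm_div, hzr, div_self (norm_ne_zero_iff.2 hr)], ?_⟩
    field_simp
    ring
  by_cases hr : r = 0
  · subst hr
    have hd0 : d = 0 := by simpa using hd
    subst hd0
    have hzr : ‖z‖ = ‖q‖ := by simp at h; linarith
    refine ⟨z / q, by rw [norm_div, hzr, div_self (norm_ne_zero_iff.2 hq)], ?_⟩
    rw [zero_mul, add_zero, mul_div_cancel₀ _ hq]
  -- The two roots of $ql^2-zl+r=0$. The focal sum evaluated at one of them forces
  -- $(|l|-1)(|l'|-1)=0$, so one root is unimodular.
  obtain ⟨w, hw⟩ := exists_sq_eq (z ^ 2 - d ^ 2)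
  have hlm : (z + w) / (2 * q) * ((z - w) / (2 * q)) = r / q := by
    field_simp
    linear_combination -hw + hd
  set l := (z + w) / (2 * q) with hl
  set l' := (z - w) / (2 * q) with hl'
  have hadd : z = q * (l + l') := by rw [hl, hl']; field_simp; ring
  have hr' : r = q * (l * l') := by rw [hlm]; field_simp
  have hl0 : l ≠ 0 := by rintro h'; apply hr; rw [hr', h']; ring
  have hl0' : l' ≠ 0 := by rintro h'; apply hr; rw [hr', h']; ring
  have e1 : z = q * l + r * l⁻¹ := by rw [hr', hadd]; field_simp
  have e2 : z = q * l' + r * l'⁻¹ := by rw [hr', hadd]; field_simp; ring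
  have hs := sum l hl0 e1
  rw [h, hr', norm_mul, norm_mul] at hs
  have p1 : 0 < ‖l‖ := norm_pos_iff.2 hl0
  have p2 : 0 < ‖q‖ := norm_pos_iff.2 hq
  have : (‖l‖ - 1) * (‖l'‖ - 1) = 0 := by
    field_simp at hs
    linear_combination hs
  rcases mul_eq_zero.1 this with h1 | h1
  · exact ⟨l, by linarith, e1⟩
  · exact ⟨l', by linarith, e2⟩

/-! ### Tangency of chords in the unit-circle parameter -/

/-- The point of the ellipse with semi-axes `a`, `b` corresponding to the point `u` of the unit
circle. -/
noncomputable def ellipsePoint (a b : ℝ) (u : ℂ) : Plane := !₂[a * u.re, b * u.im]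

@[simp] theorem ellipsePoint_zero (a b : ℝ) (u : ℂ) : ellipsePoint a b u 0 = a * u.re := rfl

@[simp] theorem ellipsePoint_one (a b : ℝ) (u : ℂ) : ellipsePoint a b u 1 = b * u.im := rfl

theorem re_sq_add_im_sq_of_norm_eq_one {u : ℂ} (hu : ‖u‖ = 1) : u.re ^ 2 + u.im ^ 2 = 1 := by
  have := Complex.sq_norm u
  rw [hu, Complex.normSq_apply] at this
  linarith

theorem conj_mul_self_of_norm_eq_one {u : ℂ} (hu : ‖u‖ = 1) : conj u * u = 1 := by
  rw [← Complex.normSq_eq_conj_mul_self, Complex.normSq_eq_norm_sq, hu]; simp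

theorem mem_outerEllipse_iff {a b : ℝ} (ha : 0 < a) (hb : 0 < b) (P : Plane) :
    P ∈ outerEllipse a b ↔ ∃ u : ℂ, ‖u‖ = 1 ∧ ellipsePoint a b u = P := by
  constructor
  · intro h
    refine ⟨⟨P 0 / a, P 1 / b⟩, ?_, ?_⟩
    · rw [Complex.norm_def, Complex.normSq_apply, Real.sqrt_eq_one]
      have h' : P 0 ^ 2 / a ^ 2 + P 1 ^ 2 / b ^ 2 = 1 := h
      rw [← h']; ring
    · ext i
      fin_cases i
      · simp [ellipsePoint]; field_simp
      · simp [ellipsePoint]; field_simp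
  · rintro ⟨u, hu, rfl⟩
    have := re_sq_add_im_sq_of_norm_eq_one hu
    change (a * u.re) ^ 2 / a ^ 2 + (b * u.im) ^ 2 / b ^ 2 = 1
    field_simp
    linarith

theorem dist_sq_plane (P Q : Plane) : dist P Q ^ 2 = (P 0 - Q 0) ^ 2 + (P 1 - Q 1) ^ 2 := by
  rw [EuclideanSpace.dist_eq, Real.sq_sqrt (by positivity)]
  simp [Real.dist_eq, sq_abs]

theorem inner_plane (P Q : Plane) : inner ℝ P Q = P 0 * Q 0 + P 1 * Q 1 := by
  simp [PiLp.inner_apply, mul_comm]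

theorem isTangent_line_iff {K : Sphere Plane} (hr : 0 ≤ K.radius) {P Q : Plane} (hPQ : P ≠ Q) :
    K.IsTangent line[ℝ, P, Q] ↔
      ((Q 0 - P 0) * (K.center 1 - P 1) - (Q 1 - P 1) * (K.center 0 - P 0)) ^ 2
        = K.radius ^ 2 * ((Q 0 - P 0) ^ 2 + (Q 1 - P 1) ^ 2) := by
  constructor
  · rintro ⟨X, hX⟩
    have hP := hX.inner_left_eq_zero_of_mem (left_mem_affineSpan_pair ℝ P Q)
    have hQ := hX.inner_left_eq_zero_of_mem (right_mem_affineSpan_pair ℝ P Q)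
    have hd := dist_sq_plane X K.center
    rw [mem_sphere.1 hX.mem_sphere] at hd
    obtain ⟨t, ht⟩ := mem_affineSpan_pair_iff_exists_lineMap_eq.1 hX.mem_space
    have h0 : X 0 = P 0 + t * (Q 0 - P 0) := by
      rw [← ht]; simp [AffineMap.lineMap_apply]; ring
    have h1 : X 1 = P 1 + t * (Q 1 - P 1) := by
      rw [← ht]; simp [AffineMap.lineMap_apply]; ring
    simp only [vsub_eq_sub, inner_plane, PiLp.sub_apply] at hP hQ
    have hs : (Q 0 - P 0) * (X 0 - K.center 0) + (Q 1 - P 1) * (X 1 - K.center 1) = 0 := by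
      linear_combination hQ - hP
    rw [hd]
    have : (Q 0 - P 0) * (K.center 1 - P 1) - (Q 1 - P 1) * (K.center 0 - P 0)
        = (Q 0 - P 0) * (K.center 1 - X 1) - (Q 1 - P 1) * (K.center 0 - X 0) := by
      rw [h0, h1]; ring
    rw [this]
    linear_combination
      -((Q 0 - P 0) * (X 0 - K.center 0) + (Q 1 - P 1) * (X 1 - K.center 1)) * hs
  · intro h
    set D := (Q 0 - P 0) ^ 2 + (Q 1 - P 1) ^ 2 with hD
    have hD0 : D ≠ 0 := by
      rw [hD, ← dist_sq_plane]
      exact pow_ne_zero 2 (dist_ne_zero.2 hPQ.symm)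
    set t := ((K.center 0 - P 0) * (Q 0 - P 0) + (K.center 1 - P 1) * (Q 1 - P 1)) / D with ht
    have htD : t * D = (K.center 0 - P 0) * (Q 0 - P 0) + (K.center 1 - P 1) * (Q 1 - P 1) := by
      rw [ht]; field_simp
    set X := AffineMap.lineMap P Q t with hX
    have h0 : X 0 = P 0 + t * (Q 0 - P 0) := by simp [hX, AffineMap.lineMap_apply]; ring
    have h1 : X 1 = P 1 + t * (Q 1 - P 1) := by simp [hX, AffineMap.lineMap_apply]; ring
    refine ⟨X, ?_, AffineMap.lineMap_mem_affineSpan_pair t P Q, ?_⟩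
    · rw [mem_sphere]
      refine (pow_left_inj₀ dist_nonneg hr two_ne_zero).1 ?_
      rw [dist_sq_plane, h0, h1]
      refine mul_right_cancel₀ hD0 ?_
      rw [← h, hD]
      rw [hD] at htD
      linear_combination (t * ((Q 0 - P 0) ^ 2 + (Q 1 - P 1) ^ 2)
        - ((K.center 0 - P 0) * (Q 0 - P 0) + (K.center 1 - P 1) * (Q 1 - P 1))) * htD
    · intro Y hY
      obtain ⟨s, hs⟩ := mem_affineSpan_pair_iff_exists_lineMap_eq.1 hY
      have y0 : Y 0 = P 0 + s * (Q 0 - P 0) := by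
        rw [← hs]; simp [AffineMap.lineMap_apply]; ring
      have y1 : Y 1 = P 1 + s * (Q 1 - P 1) := by
        rw [← hs]; simp [AffineMap.lineMap_apply]; ring
      rw [Sphere.mem_orthRadius_iff_inner_left]
      simp only [vsub_eq_sub, inner_plane, PiLp.sub_apply]
      rw [h0, h1, y0, y1]
      rw [hD] at htD
      linear_combination (s - t) * htD

theorem ellipsePoint_injective {a b : ℝ} (ha : a ≠ 0) (hb : b ≠ 0) :
    Function.Injective (ellipsePoint a b) := fun u v h ↦ by
  have h0 := congrFun (congrArg WithLp.ofLp h) 0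
  have h1 := congrFun (congrArg WithLp.ofLp h) 1
  exact Complex.ext (mul_left_cancel₀ ha h0) (mul_left_cancel₀ hb h1)

/-- The preimage of `!₂[x, y]` under the affine map taking the unit circle to the ellipse. -/
noncomputable def unitPoint (a b x y : ℝ) : ℂ := ⟨x / a, y / b⟩

/-- The product of the foci of the preimage of a circle of radius `r` under the affine map taking
the unit circle to the ellipse. -/
noncomputable def fociProd (a b x y r : ℝ) : ℂ :=
  unitPoint a b x y ^ 2 + (r ^ 2 * (1 / b ^ 2 - 1 / a ^ 2) : ℝ)

/-- The chord form of the preimage of a circle under the affine map taking the unit circle to the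
ellipse. -/
noncomputable def causticForm (a b x y r : ℝ) (u v : ℂ) : ℂ :=
  chordForm (unitPoint a b x y) (conj (unitPoint a b x y)) (fociProd a b x y r)
    (conj (fociProd a b x y r)) (r ^ 2 * (1 / a ^ 2 + 1 / b ^ 2) : ℝ) u v

theorem re_eq (u : ℂ) : (u.re : ℂ) = (u + conj u) / 2 := by
  rw [Complex.add_conj]; push_cast; ring

theorem im_eq (u : ℂ) : (u.im : ℂ) = -(Complex.I * (u - conj u)) / 2 := by
  rw [Complex.sub_conj]; push_cast; linear_combination (u.im : ℂ) * Complex.I_sq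

theorem isTangent_chord_iff {a b x y r : ℝ} (ha : 0 < a) (hb : 0 < b) (hr : 0 < r) {u v : ℂ}
    (hu : ‖u‖ = 1) (hv : ‖v‖ = 1) (huv : u ≠ v) :
    Sphere.IsTangent ⟨!₂[x, y], r⟩ line[ℝ, ellipsePoint a b u, ellipsePoint a b v] ↔
      causticForm a b x y r u v = 0 := by
  rw [isTangent_line_iff hr.le ((ellipsePoint_injective ha.ne' hb.ne').ne huv), ← sub_eq_zero,
    ← Complex.ofReal_eq_zero]
  have hu1 := conj_mul_self_of_norm_eq_one hu
  have hv1 := conj_mul_self_of_norm_eq_one hv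
  have hu0 : u ≠ 0 := by rintro rfl; simp at hu
  have hv0 : v ≠ 0 := by rintro rfl; simp at hv
  have hu2 : conj u = u⁻¹ := eq_inv_of_mul_eq_one_left hu1
  have hv2 : conj v = v⁻¹ := eq_inv_of_mul_eq_one_left hv1
  -- Both the squared cross product and the squared chord length contain $(u-v)^2$ once conjugates
  -- are replaced by inverses; the remaining factor is the form.
  have e : (((((ellipsePoint a b v) 0 - (ellipsePoint a b u) 0) * (y - (ellipsePoint a b u) 1)
      - ((ellipsePoint a b v) 1 - (ellipsePoint a b u) 1) * (x - (ellipsePoint a b u) 0)) ^ 2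
      - r ^ 2 * (((ellipsePoint a b v) 0 - (ellipsePoint a b u) 0) ^ 2
        + ((ellipsePoint a b v) 1 - (ellipsePoint a b u) 1) ^ 2) : ℝ) : ℂ)
      = -(a * b * (u - v) / (2 * (u * v))) ^ 2 * causticForm a b x y r u v := by
    have hm : unitPoint a b x y = x / a + y / b * Complex.I := by
      apply Complex.ext <;> simp [unitPoint]
    have hI : Complex.I ^ 2 = -1 := Complex.I_sq
    have ha' : (a : ℂ) ≠ 0 := by exact_mod_cast ha.ne'
    have hb' : (b : ℂ) ≠ 0 := by exact_mod_cast hb.ne'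
    unfold causticForm chordForm fociProd
    rw [hm]
    simp only [ellipsePoint_zero, ellipsePoint_one]
    push_cast
    simp only [map_add, map_mul, map_div₀, map_pow, map_sub, map_one, Complex.conj_I,
      Complex.conj_ofReal,
      re_eq, im_eq, hu2, hv2]
    generalize (a : ℂ) = a at *
    generalize (b : ℂ) = b at *
    field_simp
    ring_nf
    simp only [hI]
    ring
  have hne : -(a * b * (u - v) / (2 * (u * v))) ^ 2 ≠ 0 := by
    have ha' : (a : ℂ) ≠ 0 := by exact_mod_cast ha.ne'
    have hb' : (b : ℂ) ≠ 0 := by exact_mod_cast hb.ne'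
    have := sub_ne_zero.2 huv
    rw [neg_ne_zero]
    exact pow_ne_zero 2 (div_ne_zero (mul_ne_zero (mul_ne_zero ha' hb') this)
      (mul_ne_zero two_ne_zero (mul_ne_zero hu0 hv0)))
  refine Iff.trans (Eq.to_iff (congrArg (· = 0) e)) ?_
  rw [mul_eq_zero, or_iff_right hne]

/-! ### Circumcenter and Euler center of an inscribed triangle -/

theorem affineIndependent_ellipsePoint {a b : ℝ} (ha : a ≠ 0) (hb : b ≠ 0) {x y z : ℂ}
    (hx : ‖x‖ = 1) (hy : ‖y‖ = 1) (hz : ‖z‖ = 1) (hxy : x ≠ y) (hxz : x ≠ z) (hyz : y ≠ z) :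
    AffineIndependent ℝ (ellipsePoint a b ∘ ![x, y, z]) := by
  let f : ℂ →ₗ[ℝ] Plane :=
    { toFun := ellipsePoint a b
      map_add' := fun u v ↦ by ext i; fin_cases i <;> simp [ellipsePoint] <;> ring
      map_smul' := fun t u ↦ by ext i; fin_cases i <;> simp [ellipsePoint] <;> ring }
  refine AffineIndependent.map' (p := ![x, y, z]) ?_ f.toAffineMap (ellipsePoint_injective ha hb)
  refine Cospherical.affineIndependent_of_ne ⟨0, 1, ?_⟩ hxy hxz hyz
  simp [hx, hy, hz]

/-- The circumcenter of the triangle inscribed in the ellipse with parameters `x`, `y`, `z`. -/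
noncomputable def ellipseCircumcenter (a b : ℝ) (x y z : ℂ) : Plane :=
  !₂[(a ^ 2 - b ^ 2) / (4 * a) * ((x + y + z).re + (x * y * z).re),
    -((a ^ 2 - b ^ 2) / (4 * b) * ((x + y + z).im - (x * y * z).im))]

/-- The right-hand side is symmetric in the three parameters, which makes the point equidistant from
the vertices. -/
theorem dist_ellipseCircumcenter_sq {a b : ℝ} (ha : a ≠ 0) (hb : b ≠ 0) {x y z : ℂ}
    (hx : ‖x‖ = 1) :
    dist (ellipsePoint a b x) (ellipseCircumcenter a b x y z) ^ 2 =
      (a ^ 2 + b ^ 2) / 2 + ellipseCircumcenter a b x y z 0 ^ 2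
        + ellipseCircumcenter a b x y z 1 ^ 2
        - (a ^ 2 - b ^ 2) / 2 * (x * y + x * z + y * z).re := by
  rw [dist_sq_plane]
  have h := re_sq_add_im_sq_of_norm_eq_one hx
  have h0 : 2 * a * ellipseCircumcenter a b x y z 0
      = (a ^ 2 - b ^ 2) / 2 * ((x + y + z).re + (x * y * z).re) := by
    simp only [ellipseCircumcenter, Matrix.cons_val_zero]; field_simp; ring
  have h1 : 2 * b * ellipseCircumcenter a b x y z 1
      = -((a ^ 2 - b ^ 2) / 2 * ((x + y + z).im - (x * y * z).im)) := by
    simp only [ellipseCircumcenter, Matrix.cons_val_zero, Matrix.cons_val_one]; field_simp; ring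
  simp only [ellipsePoint_zero, ellipsePoint_one]
  simp only [Complex.add_re, Complex.add_im, Complex.mul_re, Complex.mul_im] at h0 h1 ⊢
  linear_combination -x.re * h0 - x.im * h1 + ((a ^ 2 + b ^ 2) / 2
    - (a ^ 2 - b ^ 2) / 2 * (y.re * z.re - y.im * z.im)) * h

theorem circumcenter_eq_ellipseCircumcenter {a b : ℝ} (ha : a ≠ 0) (hb : b ≠ 0)
    (T : Affine.Triangle ℝ Plane) {u : Fin 3 → ℂ} (hu : ∀ i, ‖u i‖ = 1)
    (hT : ∀ i, ellipsePoint a b (u i) = T.points i) :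
    T.circumcenter = ellipseCircumcenter a b (u 0) (u 1) (u 2) := by
  symm
  refine T.eq_circumcenter_of_dist_eq
    (r := dist (T.points 0) (ellipseCircumcenter a b (u 0) (u 1) (u 2))) ?_ ?_
  · rw [T.span_eq_top (by simp)]
    trivial
  · intro i
    refine (pow_left_inj₀ dist_nonneg dist_nonneg two_ne_zero).1 ?_
    have p1 : ellipseCircumcenter a b (u 0) (u 1) (u 2)
        = ellipseCircumcenter a b (u 1) (u 0) (u 2) := by
      unfold ellipseCircumcenter; congr 2 <;> ring_nf
    have p2 : ellipseCircumcenter a b (u 0) (u 1) (u 2)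
        = ellipseCircumcenter a b (u 2) (u 0) (u 1) := by
      unfold ellipseCircumcenter; congr 2 <;> ring_nf
    rw [← hT, ← hT, dist_ellipseCircumcenter_sq ha hb (hu 0)]
    fin_cases i
    · exact dist_ellipseCircumcenter_sq ha hb (hu 0)
    · change dist (ellipsePoint a b (u 1)) _ ^ 2 = _
      rw [p1, dist_ellipseCircumcenter_sq ha hb (hu 1)]
      ring_nf
    · change dist (ellipsePoint a b (u 2)) _ ^ 2 = _
      rw [p2, dist_ellipseCircumcenter_sq ha hb (hu 2)]
      ring_nf

/-- The point `P` of the plane as a complex number. -/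
def planeToComplex (P : Plane) : ℂ := ⟨P 0, P 1⟩

theorem dist_eq_norm_planeToComplex (P Q : Plane) :
    dist P Q = ‖planeToComplex P - planeToComplex Q‖ := by
  rw [EuclideanSpace.dist_eq, Complex.norm_def, Complex.normSq_apply]
  simp [planeToComplex, Real.dist_eq, pow_two]

theorem planeToComplex_injective : Function.Injective planeToComplex := fun P Q h ↦ by
  rw [← dist_eq_zero, dist_eq_norm_planeToComplex, h, sub_self, norm_zero]

/-- $X_5$ is the midpoint of the circumcenter $O$ and the orthocenter $A+B+C-2O$. -/
theorem eulerCenter_apply (T : Affine.Triangle ℝ Plane) (j : Fin 2) :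
    eulerCenter T j = (T.points 0 j + T.points 1 j + T.points 2 j - T.circumcenter j) / 2 := by
  unfold eulerCenter
  rw [Affine.Simplex.ninePointCircle_center, Affine.Simplex.centroid_vsub_eq]
  simp [Fin.sum_univ_three]
  ring

/-- Coefficient of `l` in the parametrization of the locus of the Euler center. -/
noncomputable def eulerCoeff (a b x y r : ℝ) : ℂ :=
  ((a + b) ^ 2 / (16 * a * b) : ℝ) * ((a + b : ℝ) * conj (fociProd a b x y r) - (a - b : ℝ))

/-- Coefficient of `l⁻¹` in the parametrization of the locus of the Euler center. -/
noncomputable def eulerCoeffInv (a b x y r : ℝ) : ℂ :=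
  -((a - b) ^ 2 / (16 * a * b) : ℝ) * ((a - b : ℝ) * fociProd a b x y r - (a + b : ℝ))

/-- Center of the locus of the Euler center. -/
noncomputable def eulerLocusCenter (a b x y : ℝ) : ℂ :=
  ⟨x * (3 * a ^ 2 + b ^ 2) / (4 * a ^ 2), y * (a ^ 2 + 3 * b ^ 2) / (4 * b ^ 2)⟩

theorem planeToComplex_eulerCenter {a b x y r : ℝ} (ha : a ≠ 0) (hb : b ≠ 0)
    (T : Affine.Triangle ℝ Plane) {u : Fin 3 → ℂ} (hu : ∀ i, ‖u i‖ = 1)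
    (hT : ∀ i, ellipsePoint a b (u i) = T.points i) {l : ℂ} (hl : u 0 * u 1 * u 2 = l)
    (hs : u 0 + u 1 + u 2 = 2 * unitPoint a b x y + l * conj (fociProd a b x y r)) :
    planeToComplex (eulerCenter T) - eulerLocusCenter a b x y
      = eulerCoeff a b x y r * l + eulerCoeffInv a b x y r * l⁻¹ := by
  have hl1 : ‖l‖ = 1 := by rw [← hl]; simp [hu]
  rw [← eq_inv_of_mul_eq_one_left (conj_mul_self_of_norm_eq_one hl1)]
  have hre := congrArg Complex.re hs
  have him := congrArg Complex.im hs
  generalize hp : fociProd a b x y r = p at *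
  simp only [unitPoint, Complex.add_re, Complex.add_im, Complex.mul_re, Complex.mul_im,
    Complex.conj_re, Complex.conj_im, Complex.re_ofNat, Complex.im_ofNat] at hre him
  have e0 : T.circumcenter 0 = (a ^ 2 - b ^ 2) / (4 * a) * ((u 0 + u 1 + u 2).re + l.re) := by
    rw [circumcenter_eq_ellipseCircumcenter ha hb T hu hT, ← hl]; rfl
  have e1 : T.circumcenter 1 = -((a ^ 2 - b ^ 2) / (4 * b) * ((u 0 + u 1 + u 2).im - l.im)) := by
    rw [circumcenter_eq_ellipseCircumcenter ha hb T hu hT, ← hl]; rfl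
  simp only [Complex.add_re, Complex.add_im] at e0 e1
  rw [hre] at e0
  rw [him] at e1
  apply Complex.ext
  · simp only [planeToComplex, eulerLocusCenter, eulerCoeff, eulerCoeffInv, hp, eulerCenter_apply,
      ← hT, ellipsePoint_zero, Complex.add_re, Complex.sub_re, Complex.sub_im, Complex.mul_re,
      Complex.mul_im, Complex.neg_re, Complex.neg_im, Complex.conj_re, Complex.conj_im,
      Complex.ofReal_re, Complex.ofReal_im, e0]
    rw [← mul_add, ← mul_add, hre]
    field_simp
    ring
  · simp only [planeToComplex, eulerLocusCenter, eulerCoeff, eulerCoeffInv, hp, eulerCenter_apply,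
      ← hT, ellipsePoint_one, Complex.add_im, Complex.sub_re, Complex.sub_im, Complex.mul_re,
      Complex.mul_im, Complex.neg_re, Complex.neg_im, Complex.conj_re, Complex.conj_im,
      Complex.ofReal_re, Complex.ofReal_im, e1]
    rw [← mul_add, ← mul_add, him]
    field_simp
    ring

/-! ### Consequences of nestedness -/

theorem causticForm_self {a b x y r : ℝ} (ha : a ≠ 0) (hb : b ≠ 0) {u : ℂ} (hu : ‖u‖ = 1) :
    causticForm a b x y r u u = 4 * u ^ 2 * ((x / a * u.re + y / b * u.im - 1) ^ 2
      - r ^ 2 * (u.re ^ 2 / a ^ 2 + u.im ^ 2 / b ^ 2) : ℝ) := by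
  have hu0 : u ≠ 0 := by rintro rfl; simp at hu
  have hu2 : conj u = u⁻¹ := eq_inv_of_mul_eq_one_left (conj_mul_self_of_norm_eq_one hu)
  have hm : unitPoint a b x y = x / a + y / b * Complex.I := by
    apply Complex.ext <;> simp [unitPoint]
  have ha' : (a : ℂ) ≠ 0 := by exact_mod_cast ha
  have hb' : (b : ℂ) ≠ 0 := by exact_mod_cast hb
  have hI : Complex.I ^ 2 = -1 := Complex.I_sq
  unfold causticForm chordForm fociProd
  rw [hm]
  push_cast
  simp only [map_add, map_mul, map_div₀, map_pow, map_sub, map_one, Complex.conj_I,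
    Complex.conj_ofReal, re_eq, im_eq, hu2]
  generalize (a : ℂ) = a at *
  generalize (b : ℂ) = b at *
  field_simp
  ring_nf
  simp only [hI]
  ring

/-- On the diagonal the form tests whether the tangent of $\mathcal E$ at `u` touches the circle.
This tangent avoids the interior of $\mathcal E$, hence the disk. The lemma forces the roots of the
cubic to be distinct. -/
theorem causticForm_self_ne_zero {a b x y r : ℝ} (ha : 0 < a) (hb : 0 < b) (hr : 0 < r)
    (hK : Metric.closedBall !₂[x, y] r ⊆ outerEllipseInterior a b) {u : ℂ} (hu : ‖u‖ = 1) :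
    causticForm a b x y r u u ≠ 0 := by
  intro h
  have hu0 : u ≠ 0 := by rintro rfl; simp at hu
  rw [causticForm_self ha.ne' hb.ne' hu, mul_eq_zero, or_iff_right (by simpa using hu0),
    Complex.ofReal_eq_zero] at h
  have h1 := re_sq_add_im_sq_of_norm_eq_one hu
  set N := u.re ^ 2 / a ^ 2 + u.im ^ 2 / b ^ 2 with hN
  have hN0 : 0 < N := by
    by_contra! hc
    have e1 : u.re ^ 2 / a ^ 2 = 0 := by
      have : 0 ≤ u.re ^ 2 / a ^ 2 := by positivity
      have : 0 ≤ u.im ^ 2 / b ^ 2 := by positivity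
      linarith
    have e2 : u.im ^ 2 / b ^ 2 = 0 := by
      have : 0 ≤ u.im ^ 2 / b ^ 2 := by positivity
      linarith
    simp [ha.ne', hb.ne'] at e1 e2
    simp [e1, e2] at h1
  set s := (1 - (x / a * u.re + y / b * u.im)) / N with hs
  have hsN : s * N = 1 - (x / a * u.re + y / b * u.im) := by rw [hs]; field_simp
  -- The foot of the perpendicular from the center to the tangent line at `u`.
  have hX : !₂[x + s * (u.re / a), y + s * (u.im / b)] ∈ Metric.closedBall !₂[x, y] r := by
    rw [Metric.mem_closedBall]
    refine (pow_le_pow_iff_left₀ dist_nonneg hr.le two_ne_zero).1 ?_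
    rw [dist_sq_plane]
    simp only [Matrix.cons_val_zero, Matrix.cons_val_one]
    refine le_of_mul_le_mul_right (le_of_eq ?_) hN0
    have : (x + s * (u.re / a) - x) ^ 2 + (y + s * (u.im / b) - y) ^ 2 = s ^ 2 * N := by
      rw [hN]; ring
    rw [this]
    linear_combination (s * N + 1 - (x / a * u.re + y / b * u.im)) * hsN + h
  have hlt : (x + s * (u.re / a)) ^ 2 / a ^ 2 + (y + s * (u.im / b)) ^ 2 / b ^ 2 < 1 := hK hX
  have hone : (x + s * (u.re / a)) / a * u.re + (y + s * (u.im / b)) / b * u.im = 1 := by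
    rw [hN] at hsN
    linear_combination hsN
  rw [← div_pow, ← div_pow] at hlt
  nlinarith [sq_nonneg ((x + s * (u.re / a)) / a - u.re),
    sq_nonneg ((y + s * (u.im / b)) / b - u.im)]

/-- The foci of the transformed circle are images of points of the disk, because
$b^2t^2=r^2-(rb/a)^2\le r^2$. -/
theorem norm_unitPoint_add_lt_one {a b x y r t : ℝ} (ha : 0 < a) (hb : 0 < b) (hr : 0 < r)
    (hK : Metric.closedBall !₂[x, y] r ⊆ outerEllipseInterior a b)
    (ht : t ^ 2 = r ^ 2 * (1 / b ^ 2 - 1 / a ^ 2)) :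
    ‖unitPoint a b x y + t * Complex.I‖ < 1 := by
  have hX : !₂[x, y + b * t] ∈ Metric.closedBall !₂[x, y] r := by
    rw [Metric.mem_closedBall]
    refine (pow_le_pow_iff_left₀ dist_nonneg hr.le two_ne_zero).1 ?_
    rw [dist_sq_plane]
    simp only [Matrix.cons_val_zero, Matrix.cons_val_one]
    have : (x - x) ^ 2 + (y + b * t - y) ^ 2 = r ^ 2 - (r * b / a) ^ 2 := by
      have : (x - x) ^ 2 + (y + b * t - y) ^ 2 = b ^ 2 * t ^ 2 := by ring
      rw [this, ht]; field_simp
    rw [this]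
    linarith [sq_nonneg (r * b / a)]
  have hlt : x ^ 2 / a ^ 2 + (y + b * t) ^ 2 / b ^ 2 < 1 := hK hX
  rw [Complex.norm_def, Real.sqrt_lt' one_pos, one_pow, Complex.normSq_apply]
  simp only [unitPoint, Complex.add_re, Complex.add_im, Complex.mul_re, Complex.mul_im,
    Complex.ofReal_re, Complex.ofReal_im, Complex.I_re, Complex.I_im]
  convert hlt using 1
  field_simp
  ring

/-! ### Poncelet's porism for triangles and the parametrized locus -/

/-- The closure condition for Poncelet triangles about the circle with center `!₂[x, y]` and
radius `r`. -/
def PonceletClosure (a b x y r : ℝ) : Prop :=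
  1 - 2 * (unitPoint a b x y * conj (unitPoint a b x y))
    + fociProd a b x y r * conj (fociProd a b x y r) = 2 * (r ^ 2 * (1 / a ^ 2 + 1 / b ^ 2) : ℝ)

theorem IsPonceletTriangle.exists_param {a b x y r : ℝ} (ha : 0 < a) (hb : 0 < b) (hr : 0 < r)
    {T : Affine.Triangle ℝ Plane} (hT : IsPonceletTriangle a b ⟨!₂[x, y], r⟩ T) :
    ∃ u : Fin 3 → ℂ, (∀ i, ‖u i‖ = 1) ∧ (∀ i, ellipsePoint a b (u i) = T.points i) ∧
      u 0 + u 1 + u 2 = 2 * unitPoint a b x y + u 0 * u 1 * u 2 * conj (fociProd a b x y r) ∧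
      PonceletClosure a b x y r := by
  choose u hu hTu using fun i ↦ (mem_outerEllipse_iff ha hb _).1 (hT.inscribed i)
  have hne : ∀ i j, i ≠ j → u i ≠ u j := fun i j hij h ↦
    T.independent.injective.ne hij (by rw [← hTu, ← hTu, h])
  have hform : ∀ i j, i ≠ j → causticForm a b x y r (u i) (u j) = 0 := fun i j hij ↦ by
    rw [← isTangent_chord_iff ha hb hr (hu i) (hu j) (hne i j hij), hTu, hTu]
    exact hT.tangent i j hij
  obtain ⟨h1, -, h3⟩ := symmetric_functions_of_chordForm (hne 0 1 (by decide))
    (hne 0 2 (by decide)) (hne 1 2 (by decide)) (hform 0 1 (by decide)) (hform 0 2 (by decide))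
    (hform 1 2 (by decide))
  exact ⟨u, hu, hTu, h1, h3⟩

/-- The vertices are the Blaschke roots for the foci $m\pm it$, whose sum is $2m$ and whose product
is `fociProd`. -/
theorem exists_isPonceletTriangle {a b x y r : ℝ} (hb : 0 < b) (hab : b < a) (hr : 0 < r)
    (hK : Metric.closedBall !₂[x, y] r ⊆ outerEllipseInterior a b)
    (hc : PonceletClosure a b x y r) {l : ℂ} (hl : ‖l‖ = 1) :
    ∃ T : Affine.Triangle ℝ Plane, IsPonceletTriangle a b ⟨!₂[x, y], r⟩ T ∧
      ∃ u : Fin 3 → ℂ, (∀ i, ‖u i‖ = 1) ∧ (∀ i, ellipsePoint a b (u i) = T.points i) ∧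
        u 0 * u 1 * u 2 = l ∧
        u 0 + u 1 + u 2 = 2 * unitPoint a b x y + l * conj (fociProd a b x y r) := by
  have ha : 0 < a := hb.trans hab
  have hk : 0 ≤ r ^ 2 * (1 / b ^ 2 - 1 / a ^ 2) := by
    refine mul_nonneg (sq_nonneg r) (sub_nonneg.2 ?_)
    gcongr
  set t := √(r ^ 2 * (1 / b ^ 2 - 1 / a ^ 2)) with ht
  have ht2 : t ^ 2 = r ^ 2 * (1 / b ^ 2 - 1 / a ^ 2) := Real.sq_sqrt hk
  have hf := norm_unitPoint_add_lt_one ha hb hr hK ht2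
  have hg := norm_unitPoint_add_lt_one ha hb hr hK (t := -t) (by rw [neg_sq, ht2])
  obtain ⟨z0, z1, z2, n0, n1, n2, hprod, hsum, hsum2⟩ := exists_unit_roots hf hg hl
  have hfg : (unitPoint a b x y + (t : ℂ) * Complex.I)
      * (unitPoint a b x y + ((-t : ℝ) : ℂ) * Complex.I) = fociProd a b x y r := by
    unfold fociProd
    rw [← ht2]
    push_cast
    linear_combination -(t : ℂ) ^ 2 * Complex.I_sq
  have hadd : (unitPoint a b x y + (t : ℂ) * Complex.I)
      + (unitPoint a b x y + ((-t : ℝ) : ℂ) * Complex.I) = 2 * unitPoint a b x y := by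
    push_cast; ring
  rw [hfg, hadd] at hsum hsum2
  rw [map_mul, Complex.conj_ofNat] at hsum2
  have form : ∀ {u v w : ℂ}, ‖u‖ = 1 → u * v * w = l →
      u + v + w = 2 * unitPoint a b x y + l * conj (fociProd a b x y r) →
      u * v + u * w + v * w
        = fociProd a b x y r + l * (2 * conj (unitPoint a b x y)) →
      causticForm a b x y r u v = 0 := by
    intro u v w hu h1 h2 h3
    refine chordForm_eq_zero (z := w) (by rintro rfl; simp at hu) ?_ ?_ hc
    · rw [h1, h2]
    · rw [h1, h3]; ring
  have f01 := form n0 hprod hsum hsum2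
  have f02 := form (v := z2) (w := z1) n0 (by linear_combination hprod)
    (by linear_combination hsum) (by linear_combination hsum2)
  have f12 := form (v := z2) (w := z0) n1 (by linear_combination hprod)
    (by linear_combination hsum) (by linear_combination hsum2)
  have hself : ∀ {u v : ℂ}, ‖u‖ = 1 → causticForm a b x y r u v = 0 → u ≠ v := by
    rintro u v hu h rfl
    exact causticForm_self_ne_zero ha hb hr hK hu h
  have d01 := hself n0 f01
  have d02 := hself n0 f02
  have d12 := hself n1 f12
  have g01 := (isTangent_chord_iff ha hb hr n0 n1 d01).2 f01
  have g02 := (isTangent_chord_iff ha hb hr n0 n2 d02).2 f02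
  have g12 := (isTangent_chord_iff ha hb hr n1 n2 d12).2 f12
  have hn : ∀ i, ‖(![z0, z1, z2] : Fin 3 → ℂ) i‖ = 1 := by
    intro i; fin_cases i <;> assumption
  refine ⟨⟨_, affineIndependent_ellipsePoint ha.ne' hb.ne' n0 n1 n2 d01 d02 d12⟩,
    ⟨fun i ↦ (mem_outerEllipse_iff ha hb _).2 ⟨_, hn i, rfl⟩, ?_⟩,
    ![z0, z1, z2], hn, fun _ ↦ rfl, hprod, hsum⟩
  have comm : ∀ P Q : Plane, line[ℝ, P, Q] = line[ℝ, Q, P] := fun P Q ↦ by rw [Set.pair_comm]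
  intro i j hij
  fin_cases i <;> fin_cases j
  · exact absurd rfl hij
  · exact g01
  · exact g02
  · exact (comm _ _).subst (motive := Sphere.IsTangent _) g01
  · exact absurd rfl hij
  · exact g12
  · exact (comm _ _).subst (motive := Sphere.IsTangent _) g02
  · exact (comm _ _).subst (motive := Sphere.IsTangent _) g12
  · exact absurd rfl hij

theorem mem_eulerCenterLocus_iff {a b x y r : ℝ} (hb : 0 < b) (hab : b < a) (hr : 0 < r)
    (hK : Metric.closedBall !₂[x, y] r ⊆ outerEllipseInterior a b)
    (hc : PonceletClosure a b x y r) (P : Plane) :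
    P ∈ eulerCenterLocus a b ⟨!₂[x, y], r⟩ ↔
      ∃ l : ℂ, ‖l‖ = 1 ∧ planeToComplex P - eulerLocusCenter a b x y
        = eulerCoeff a b x y r * l + eulerCoeffInv a b x y r * l⁻¹ := by
  have ha : 0 < a := hb.trans hab
  constructor
  · rintro ⟨T, hT, rfl⟩
    obtain ⟨u, hu, hTu, hs, -⟩ := hT.exists_param ha hb hr
    exact ⟨u 0 * u 1 * u 2, by simp [hu],
      planeToComplex_eulerCenter ha.ne' hb.ne' T hu hTu rfl hs⟩
  · rintro ⟨l, hl, hP⟩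
    obtain ⟨T, hT, u, hu, hTu, hprod, hs⟩ := exists_isPonceletTriangle hb hab hr hK hc hl
    refine ⟨T, hT, planeToComplex_injective ?_⟩
    have := planeToComplex_eulerCenter ha.ne' hb.ne' T hu hTu hprod hs
    rw [← hP] at this
    exact sub_left_injective this

/-! ### Foci and axes from the closure condition -/

theorem PonceletClosure.real_form {a b x y r : ℝ} (hc : PonceletClosure a b x y r) :
    1 - 2 * ((x / a) ^ 2 + (y / b) ^ 2)
      + (((x / a) ^ 2 - (y / b) ^ 2 + r ^ 2 * (1 / b ^ 2 - 1 / a ^ 2)) ^ 2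
        + (2 * (x / a) * (y / b)) ^ 2) = 2 * (r ^ 2 * (1 / a ^ 2 + 1 / b ^ 2)) := by
  have h := congrArg Complex.re hc
  simp only [fociProd, unitPoint, pow_two, Complex.add_re, Complex.sub_re, Complex.mul_re,
    Complex.add_im, Complex.mul_im, Complex.conj_re, Complex.conj_im, Complex.ofReal_re,
    Complex.ofReal_im, Complex.re_ofNat, Complex.im_ofNat, Complex.one_re] at h
  linear_combination h

theorem PonceletClosure.focal_sq {a b x y r : ℝ} (ha : a ≠ 0) (hb : b ≠ 0)
    (hc : PonceletClosure a b x y r) :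
    (⟨(a ^ 2 - b ^ 2) / 4 * (x / a ^ 2), -((a ^ 2 - b ^ 2) / 4 * (y / b ^ 2))⟩ : ℂ) ^ 2
      = 4 * eulerCoeff a b x y r * eulerCoeffInv a b x y r := by
  have h := hc.real_form
  -- Allows $r^2(1/a^2+1/b^2)$ to be eliminated in favor of $k=r^2(1/b^2-1/a^2)$.
  have he : (a ^ 2 - b ^ 2) * (r ^ 2 * (1 / a ^ 2 + 1 / b ^ 2))
      = (a ^ 2 + b ^ 2) * (r ^ 2 * (1 / b ^ 2 - 1 / a ^ 2)) := by
    field_simp; ring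
  have hx : x / a ^ 2 = x / a / a := by field_simp
  have hy : y / b ^ 2 = y / b / b := by field_simp
  apply Complex.ext
  all_goals
    simp only [eulerCoeff, eulerCoeffInv, fociProd, unitPoint, pow_two, Complex.add_re,
      Complex.sub_re, Complex.mul_re, Complex.neg_re, Complex.neg_im, Complex.sub_im,
      Complex.add_im, Complex.mul_im, Complex.conj_re, Complex.conj_im, Complex.ofReal_re,
      Complex.ofReal_im, Complex.re_ofNat, Complex.im_ofNat]
  · simp only [← pow_two]
    rw [hx, hy]
    generalize x / a = α at *
    generalize y / b = β at *
    generalize r ^ 2 * (1 / b ^ 2 - 1 / a ^ 2) = k at *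
    generalize r ^ 2 * (1 / a ^ 2 + 1 / b ^ 2) = e at *
    field_simp
    linear_combination (64 * (a ^ 2 - b ^ 2) ^ 3) * h + 128 * (a ^ 2 - b ^ 2) ^ 2 * he
  · simp only [← pow_two]
    field_simp
    ring

theorem norm_eq_of_sq_eq {z : ℂ} {t : ℝ} (ht : 0 ≤ t) (h : z.re ^ 2 + z.im ^ 2 = t ^ 2) :
    ‖z‖ = t := by
  refine (pow_left_inj₀ (norm_nonneg z) ht two_ne_zero).1 ?_
  rw [Complex.sq_norm, Complex.normSq_apply, ← h]; ring

/-- The squared relation is the closure condition in other terms; nestedness makes the right-hand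
side nonnegative and so fixes the sign of the root. -/
theorem PonceletClosure.two_mul_sqrt_mul_sqrt {a b x y r : ℝ} (hb : 0 < b) (hab : b < a)
    (hr : 0 < r) (hK : Metric.closedBall !₂[x, y] r ⊆ outerEllipseInterior a b)
    (hc : PonceletClosure a b x y r) {S R : ℝ} (hS0 : 0 ≤ S) (hR0 : 0 ≤ R)
    (hS : S ^ 2 = b ^ 2 + (a ^ 2 - b ^ 2) * (y / b) ^ 2)
    (hR : R ^ 2 = a ^ 2 - (a ^ 2 - b ^ 2) * (x / a) ^ 2) :
    2 * (S * R) = b ^ 2 + (a ^ 2 - b ^ 2) * (y / b) ^ 2 + (a ^ 2 - (a ^ 2 - b ^ 2) * (x / a) ^ 2)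
      - (a ^ 2 - b ^ 2) * (r ^ 2 * (1 / b ^ 2 - 1 / a ^ 2)) := by
  have ha : 0 < a := hb.trans hab
  have h := hc.real_form
  have he : (a ^ 2 - b ^ 2) * (r ^ 2 * (1 / a ^ 2 + 1 / b ^ 2))
      = (a ^ 2 + b ^ 2) * (r ^ 2 * (1 / b ^ 2 - 1 / a ^ 2)) := by
    field_simp; ring
  have hk : 0 ≤ r ^ 2 * (1 / b ^ 2 - 1 / a ^ 2) := by
    refine mul_nonneg (sq_nonneg r) (sub_nonneg.2 ?_)
    gcongr
  set t := √(r ^ 2 * (1 / b ^ 2 - 1 / a ^ 2)) with ht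
  have ht2 : t ^ 2 = r ^ 2 * (1 / b ^ 2 - 1 / a ^ 2) := Real.sq_sqrt hk
  have sq_lt : ∀ {s : ℝ}, s ^ 2 = r ^ 2 * (1 / b ^ 2 - 1 / a ^ 2) →
      (x / a) ^ 2 + (y / b + s) ^ 2 < 1 := fun {s} hs ↦ by
    have := norm_unitPoint_add_lt_one ha hb hr hK hs
    rw [Complex.norm_def, Real.sqrt_lt' one_pos, one_pow, Complex.normSq_apply] at this
    simp only [unitPoint, Complex.add_re, Complex.add_im, Complex.mul_re, Complex.mul_im,
      Complex.ofReal_re, Complex.ofReal_im, Complex.I_re, Complex.I_im] at this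
    linarith
  have l1 := sq_lt ht2
  have l2 := sq_lt (s := -t) (by rw [neg_sq, ht2])
  -- The mean of the bounds $|m\pm it|^2<1$.
  have hsum : (x / a) ^ 2 + (y / b) ^ 2 + r ^ 2 * (1 / b ^ 2 - 1 / a ^ 2) < 1 := by
    rw [← ht2]; linarith
  have hcpos : 0 < a ^ 2 - b ^ 2 := by nlinarith
  refine (pow_left_inj₀ (by positivity) ?_ two_ne_zero).1 ?_
  · have := mul_lt_mul_of_pos_left hsum hcpos
    nlinarith [mul_nonneg hcpos.le (sq_nonneg (y / b))]
  · generalize x / a = α at *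
    generalize y / b = β at *
    generalize r ^ 2 * (1 / b ^ 2 - 1 / a ^ 2) = k at *
    generalize r ^ 2 * (1 / a ^ 2 + 1 / b ^ 2) = e at *
    linear_combination 4 * R ^ 2 * hS + 4 * (b ^ 2 + (a ^ 2 - b ^ 2) * β ^ 2) * hR
      - (a ^ 2 - b ^ 2) ^ 2 * h - 2 * (a ^ 2 - b ^ 2) * he

/-- Up to scaling, the squared moduli are $a^2S^2+b^2R^2\mp2abSR$, with $SR$ supplied by the closure
condition; hence they are perfect squares. -/
theorem PonceletClosure.norm_coeffs {a b x y r : ℝ} (hb : 0 < b) (hab : b < a)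
    (hr : 0 < r) (hK : Metric.closedBall !₂[x, y] r ⊆ outerEllipseInterior a b)
    (hc : PonceletClosure a b x y r) {S R : ℝ} (hS0 : 0 ≤ S) (hR0 : 0 ≤ R)
    (hS : S ^ 2 = b ^ 2 + (a ^ 2 - b ^ 2) * (y / b) ^ 2)
    (hR : R ^ 2 = a ^ 2 - (a ^ 2 - b ^ 2) * (x / a) ^ 2) :
    ‖eulerCoeff a b x y r‖ = (a + b) ^ 2 * (a * S - b * R) / (8 * a * b * (a - b)) ∧
      ‖eulerCoeffInv a b x y r‖ = (a - b) ^ 2 * (a * S + b * R) / (8 * a * b * (a + b)) := by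
  have ha : 0 < a := hb.trans hab
  have hd : 0 < a - b := sub_pos.2 hab
  have h := hc.real_form
  have he : (a ^ 2 - b ^ 2) * (r ^ 2 * (1 / a ^ 2 + 1 / b ^ 2))
      = (a ^ 2 + b ^ 2) * (r ^ 2 * (1 / b ^ 2 - 1 / a ^ 2)) := by
    field_simp; ring
  have key := hc.two_mul_sqrt_mul_sqrt hb hab hr hK hS0 hR0 hS hR
  have hcpos : 0 < a ^ 2 - b ^ 2 := by nlinarith
  have hle : b * R ≤ a * S := by
    refine (pow_le_pow_iff_left₀ (by positivity) (by positivity) two_ne_zero).1 ?_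
    rw [mul_pow, mul_pow, hS, hR]
    nlinarith [mul_nonneg hcpos.le (sq_nonneg (a * (y / b))),
      mul_nonneg hcpos.le (sq_nonneg (b * (x / a)))]
  constructor
  · refine norm_eq_of_sq_eq ?_ ?_
    · have := sub_nonneg.2 hle
      positivity
    simp only [eulerCoeff, fociProd, unitPoint, pow_two, Complex.add_re,
      Complex.sub_re, Complex.mul_re, Complex.sub_im,
      Complex.add_im, Complex.mul_im, Complex.conj_re, Complex.conj_im, Complex.ofReal_re,
      Complex.ofReal_im]
    simp only [← pow_two]
    generalize x / a = α at *
    generalize y / b = β at *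
    generalize r ^ 2 * (1 / b ^ 2 - 1 / a ^ 2) = k at *
    generalize r ^ 2 * (1 / a ^ 2 + 1 / b ^ 2) = e at *
    have main : (a - b) ^ 2 * (((a + b) * (α ^ 2 - β ^ 2 + k) - (a - b)) ^ 2
        + ((a + b) * (2 * α * β)) ^ 2) = 4 * (a * S - b * R) ^ 2 := by
      linear_combination (a ^ 2 - b ^ 2) ^ 2 * h + 2 * (a ^ 2 - b ^ 2) * he - 4 * a ^ 2 * hS
        - 4 * b ^ 2 * hR + 4 * a * b * key
    have hq : (a + b) ^ 2 / (16 * a * b) * (16 * a * b) = (a + b) ^ 2 := by field_simp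
    generalize (a + b) ^ 2 / (16 * a * b) = q at *
    rw [div_pow, eq_div_iff (by positivity)]
    linear_combination (a + b) ^ 4 / 4 * main + (a - b) ^ 2
      * (((a + b) * (α ^ 2 - β ^ 2 + k) - (a - b)) ^ 2 + ((a + b) * (2 * α * β)) ^ 2)
      * (q * (16 * a * b) + (a + b) ^ 2) / 4 * hq
  · refine norm_eq_of_sq_eq (by positivity) ?_
    simp only [eulerCoeffInv, fociProd, unitPoint, pow_two, Complex.add_re,
      Complex.sub_re, Complex.mul_re, Complex.sub_im, Complex.neg_re, Complex.neg_im,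
      Complex.add_im, Complex.mul_im, Complex.ofReal_re,
      Complex.ofReal_im]
    simp only [← pow_two]
    generalize x / a = α at *
    generalize y / b = β at *
    generalize r ^ 2 * (1 / b ^ 2 - 1 / a ^ 2) = k at *
    generalize r ^ 2 * (1 / a ^ 2 + 1 / b ^ 2) = e at *
    have main : (a + b) ^ 2 * (((a - b) * (α ^ 2 - β ^ 2 + k) - (a + b)) ^ 2
        + ((a - b) * (2 * α * β)) ^ 2) = 4 * (a * S + b * R) ^ 2 := by
      linear_combination (a ^ 2 - b ^ 2) ^ 2 * h + 2 * (a ^ 2 - b ^ 2) * he - 4 * a ^ 2 * hS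
        - 4 * b ^ 2 * hR - 4 * a * b * key
    have hq : (a - b) ^ 2 / (16 * a * b) * (16 * a * b) = (a - b) ^ 2 := by field_simp
    generalize (a - b) ^ 2 / (16 * a * b) = q at *
    rw [div_pow, eq_div_iff (by positivity)]
    linear_combination (a - b) ^ 4 / 4 * main + (a + b) ^ 2
      * (((a - b) * (α ^ 2 - β ^ 2 + k) - (a + b)) ^ 2 + ((a - b) * (2 * α * β)) ^ 2)
      * (q * (16 * a * b) + (a - b) ^ 2) / 4 * hq

theorem mainTheorem3 (a b xc yc r : ℝ) (hb : 0 < b) (hab : b < a)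
    (hK : IsCircularCaustic a b ⟨!₂[xc, yc], r⟩) :
    IsEllipseWithFoci (eulerCenterLocus a b ⟨!₂[xc, yc], r⟩)
      !₂[xc, yc]
      !₂[xc * (1 + (b / a) ^ 2) / 2, yc * (1 + (a / b) ^ 2) / 2]
      (eulerSemiMajor a b xc yc) (eulerSemiMinor a b xc yc) := by
  have ha : 0 < a := hb.trans hab
  have hd : 0 < a - b := sub_pos.2 hab
  have hcpos : 0 < a ^ 2 - b ^ 2 := by nlinarith
  have hr : 0 < r := hK.radius_pos
  have hn : Metric.closedBall !₂[xc, yc] r ⊆ outerEllipseInterior a b := hK.nested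
  -- One triangle yields the closure condition, and with it the whole family.
  obtain ⟨T, hT⟩ := hK.closes
  obtain ⟨-, -, -, -, hc⟩ := hT.exists_param ha hb hr
  have hmem : xc ^ 2 / a ^ 2 + yc ^ 2 / b ^ 2 < 1 := hn (Metric.mem_closedBall_self hr.le)
  have hxc : xc ^ 2 < a ^ 2 := by
    have : 0 ≤ yc ^ 2 / b ^ 2 := by positivity
    exact (div_lt_one (by positivity)).1 (by linarith)
  have hR4 : 0 ≤ a ^ 4 - (a ^ 2 - b ^ 2) * xc ^ 2 := by
    nlinarith [mul_pos hcpos (sub_pos.2 hxc), mul_pos (pow_pos ha 2) (pow_pos hb 2)]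
  have hS4 : 0 ≤ b ^ 4 + (a ^ 2 - b ^ 2) * yc ^ 2 := by positivity
  set S := √(b ^ 4 + (a ^ 2 - b ^ 2) * yc ^ 2) with hS
  set R := √(a ^ 4 - (a ^ 2 - b ^ 2) * xc ^ 2) with hR
  have hS2 : S ^ 2 = b ^ 4 + (a ^ 2 - b ^ 2) * yc ^ 2 := Real.sq_sqrt hS4
  have hR2 : R ^ 2 = a ^ 4 - (a ^ 2 - b ^ 2) * xc ^ 2 := Real.sq_sqrt hR4
  have hSpos : 0 < S := Real.sqrt_pos.2 (by positivity)
  have hR0 : 0 ≤ R := Real.sqrt_nonneg _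
  obtain ⟨hq, hq'⟩ := hc.norm_coeffs hb hab hr hn (S := S / b) (R := R / a)
    (by positivity) (by positivity)
    (by rw [div_pow, hS2]; field_simp) (by rw [div_pow, hR2]; field_simp)
  set q := eulerCoeff a b xc yc r
  set q' := eulerCoeffInv a b xc yc r
  have hmajor : eulerSemiMajor a b xc yc = ‖q‖ + ‖q'‖ := by
    have hs : a ^ 2 - b ^ 2 = (a - b) * (a + b) := by ring
    rw [hq, hq', eulerSemiMajor, ← hS, ← hR, hs]
    field_simp
    ring
  have hminor : eulerSemiMinor a b xc yc = |‖q‖ - ‖q'‖| := by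
    have h4 : 0 < 4 * a * b * (a ^ 2 - b ^ 2) := by positivity
    rw [eulerSemiMinor, ← hS, ← hR, ← abs_of_pos h4, ← abs_div, hq, hq']
    have hs : a ^ 2 - b ^ 2 = (a - b) * (a + b) := by ring
    rw [hs]
    congr 1
    field_simp
    ring
  -- Only `q` can vanish; that is the case of a circular locus.
  have hq'pos : 0 < ‖q'‖ := by
    rw [hq']
    positivity
  have hfocal := hc.focal_sq ha.ne' hb.ne'
  -- The displacement of $C$ from the center of the locus.
  set δ : ℂ := ⟨(a ^ 2 - b ^ 2) / 4 * (xc / a ^ 2), -((a ^ 2 - b ^ 2) / 4 * (yc / b ^ 2))⟩ with hδ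
  have hF : planeToComplex !₂[xc, yc] = eulerLocusCenter a b xc yc + δ := by
    apply Complex.ext
    · simp [planeToComplex, eulerLocusCenter, hδ]; field_simp; ring
    · simp [planeToComplex, eulerLocusCenter, hδ]; field_simp; ring
  have hF' : planeToComplex !₂[xc * (1 + (b / a) ^ 2) / 2, yc * (1 + (a / b) ^ 2) / 2]
      = eulerLocusCenter a b xc yc - δ := by
    apply Complex.ext
    · simp [planeToComplex, eulerLocusCenter, hδ]; field_simp; ring
    · simp [planeToComplex, eulerLocusCenter, hδ]; field_simp; ring
  have hδn : ‖δ‖ ^ 2 = 4 * ‖q‖ * ‖q'‖ := by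
    rw [← norm_pow, hfocal, norm_mul, norm_mul, Complex.norm_ofNat]
  refine ⟨?_, ?_, ?_, ?_, ?_⟩
  · rw [hmajor]
    positivity
  · rw [hminor]
    exact abs_nonneg _
  · rw [hminor, hmajor, abs_le]
    constructor <;> linarith [norm_nonneg q, norm_nonneg q']
  · rw [dist_eq_norm_planeToComplex, hF, hF', hmajor, hminor, sq_abs]
    rw [show (‖q‖ + ‖q'‖) ^ 2 - (‖q‖ - ‖q'‖) ^ 2 = ‖δ‖ ^ 2 by rw [hδn]; ring,
      Real.sqrt_sq (norm_nonneg _),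
      show eulerLocusCenter a b xc yc + δ - (eulerLocusCenter a b xc yc - δ) = 2 * δ by ring,
      norm_mul, Complex.norm_ofNat]
  · ext P
    rw [mem_eulerCenterLocus_iff hb hab hr hn hc,
      exists_unit_iff_sum_norm_eq hfocal (by positivity), ← hmajor]
    change _ ↔ dist P _ + dist P _ = _
    rw [dist_eq_norm_planeToComplex, dist_eq_norm_planeToComplex, hF, hF', sub_sub, sub_add]
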